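/- For $p\ge 3$ put $\lambda_p=2\cos(\pi/p)$. An infinite frieze pattern is a real array $\mathcal F=(m_{i,j})_{i\le j}$, $i,j\in\mathbb Z$, with $m_{i,i}=0$, $m_{i,i+1}=1$ and $m_{i-1,j}m_{i,j+1}-m_{i,j}m_{i-1,j+1}=1$ for all $i\le j$. Let $n\ge 1$ and let $\mathcal F$ be an infinite frieze pattern whose quiddity sequence $(m_{i-1,i+1})_{i\in\mathbb Z}$ is $n$-periodic. Let $p_1,\dots,p_s\ge 3$ be integers and let $\mathcal F$ be of Type $\Lambda_{p_1,\ldots,p_s}$, i.e. each $m_{i-1,i+1}$ is a sum of non-negative integral multiples of $\lambda_{p_1},\dots,\lambda_{p_s}$. Write $m_{i-1,i+1}=\sum_{p\in A_i}\lambda_p$ with $A_i$ a multiset of integers that are at least $3$. Suppose that $\mathcal F$ satisfies the skeletal realizability criteria: (0) for each $p\ge 3$, every string of consecutive quiddity entries equal to $\lambda_p$ has length smaller than $p-2$; (i) $A_i\cap A_{i+1}\ne\emptyset$ for all $i$, and there is no $p\ge3$ for which $A_i=\{p\}$ for more than $p-2$ consecutive indices $i$ while $A_j\neq\{p\}$ for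 some $j$; (ii) one can choose $p_{i,i+1}\in A_i\cap A_{i+1}$, with indices taken modulo $n$, such that for every $i$ with $|A_i|>1$ and $p_{i-1,i}=p_{i,i+1}$ one has $\{p_{i-1,i},p_{i,i+1}\}\subseteq A_i$ as multisets. Let $S_n$ be the once-punctured disc with boundary vertices $v_1,\dots,v_n$ in counterclockwise order (indices modulo $n$). A dissection of $S_n$ is a set of pairwise non-crossing arcs (up to isotopy, with endpoints among the $v_i$ and the puncture) that divides $S_n$ into polygons, called subgons. We say that $\mathcal F$ is realizable by a dissection of $S_n$ if there is a dissection of $S_n$ such that, for every $i$, $m_{i-1,i+1}=\sum_{\mathcal P}\lambda_{|\mathcal P|}$, where $\mathcal P$ runs over the subgons met by a small half circle around $v_i$ (so a self-folded subgon is counted once for each of its corners at $v_i$) and $|\mathcal P|$ is the number of sides of $\mathcal P$. Then $\mathcal F$ is realizable by a dissection of $S_n$ if and only if its first growth coefficient $s_1=m_{0,n+1}-m_{1,n}$ equals $2$. -/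

import Mathlib

noncomputable section

/-- An infinite frieze pattern over `R`: an array `m i j` (`i ≤ j`) of shifted infinite rows whose
first two rows are `0`s and `1`s, and each of whose diamonds satisfies the unimodular rule
`left * right - top * bottom = 1`.  Values `m i j` with `j < i` are not part of the pattern and
carry no information. -/
structure InfiniteFrieze (R : Type*) [CommRing R] where
  m : ℤ → ℤ → R
  diag_zero : ∀ i : ℤ, m i i = 0
  diag_one : ∀ i : ℤ, m i (i + 1) = 1
  unimodular : ∀ i j : ℤ, i ≤ j →
    m (i - 1) j * m i (j + 1) - m i j * m (i - 1) (j + 1) = 1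

namespace InfiniteFrieze

/-- The quiddity row, indexed so that the entry belonging to the vertex `v_i` is `m_{i-1,i+1}`. -/
def quiddity {R : Type*} [CommRing R] (F : InfiniteFrieze R) (i : ℤ) : R :=
  F.m (i - 1) (i + 1)

/-- The quiddity row is `n`-periodic, so `(m_{0,2}, …, m_{n-1,n+1})` is a quiddity cycle. -/
def IsPeriodic {R : Type*} [CommRing R] (F : InfiniteFrieze R) (n : ℕ) : Prop :=
  ∀ i : ℤ, F.quiddity (i + n) = F.quiddity i

/-- The `k`-th growth coefficient of an `n`-periodic infinite frieze pattern: the common value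
of `m_{i,i+kn+1} - m_{i+1,i+kn}`, read off at `i = 0`. -/
def growthCoeff {R : Type*} [CommRing R] (F : InfiniteFrieze R) (n k : ℕ) : R :=
  F.m 0 (k * n + 1) - F.m 1 (k * n)

end InfiniteFrieze

/-- `λ_p = 2 cos (π / p)`. -/
def friezeLambda (p : ℕ) : ℝ := 2 * Real.cos (Real.pi / p)

/-- `∑_{p ∈ A} λ_p`, with multiplicities. -/
def lambdaSum (A : Multiset ℕ) : ℝ := (A.map friezeLambda).sum

namespace InfiniteFrieze

/-- Type `Λ_{p_1,…,p_s}` for `P = {p_1,…,p_s}`: each quiddity entry is a sum of non-negative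
integral multiples of `λ_{p_1}, …, λ_{p_s}`. -/
def IsOfType (F : InfiniteFrieze ℝ) (P : Finset ℕ) : Prop :=
  ∀ i : ℤ, ∃ c : ℕ → ℕ, F.quiddity i = ∑ p ∈ P, (c p : ℝ) * friezeLambda p

/-- Every string of consecutive quiddity entries `λ_p` is shorter than `p - 2`. -/
def IsSkeletal (F : InfiniteFrieze ℝ) : Prop :=
  ∀ p : ℕ, 3 ≤ p → ¬ ∃ i : ℤ, ∀ k : ℕ, k < p - 2 → F.quiddity (i + k) = friezeLambda p

/-- `A_i` is a multiset of integers, all at least `3`, with `m_{i-1,i+1} = ∑_{p ∈ A_i} λ_p`. -/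
def IsSizeSequence (F : InfiniteFrieze ℝ) (A : ℤ → Multiset ℕ) : Prop :=
  ∀ i : ℤ, (∀ p ∈ A i, 3 ≤ p) ∧ F.quiddity i = lambdaSum (A i)

end InfiniteFrieze

/-- The realizability test: neither (1) are there neighbours with `A_i ∩ A_{i+1} = ∅`, nor
(2) are there, for some `p ≥ 3`, more than `p - 2` consecutive indices with `A_i = {p}` while
`A_j ≠ {p}` for some `j`. -/
def PassesRealizabilityTest (A : ℤ → Multiset ℕ) : Prop :=
  (¬ ∃ i : ℤ, A i ∩ A (i + 1) = ∅) ∧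
  ¬ ∃ p : ℕ, 3 ≤ p ∧ (∃ i : ℤ, ∀ k : ℕ, k < p - 1 → A (i + k) = {p}) ∧ ∃ j : ℤ, A j ≠ {p}

/-- One can choose, for indices modulo `n`, numbers `q i = p_{i,i+1} ∈ A_i ∩ A_{i+1}` such that
`{p_{i-1,i}, p_{i,i+1}} ⊆ A_i` as multisets whenever `|A_i| > 1` and `p_{i-1,i} = p_{i,i+1}`. -/
def HasOuterSizeChoice (n : ℕ) (A : ℤ → Multiset ℕ) : Prop :=
  ∃ q : ℤ → ℕ, (∀ i : ℤ, q (i + n) = q i) ∧ (∀ i : ℤ, q i ∈ A i ∩ A (i + 1)) ∧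
    ∀ i : ℤ, 1 < (A i).card → q (i - 1) = q i → ({q (i - 1), q i} : Multiset ℕ) ≤ A i

/-- The skeletal realizability criteria for the quiddity cycle of length `n`. -/
def InfiniteFrieze.SatisfiesSkeletalCriteria (F : InfiniteFrieze ℝ) (n : ℕ) : Prop :=
  F.IsSkeletal ∧ ∃ A : ℤ → Multiset ℕ, F.IsSizeSequence A ∧
    PassesRealizabilityTest A ∧ HasOuterSizeChoice n A

/-! ### Dissections of the once-punctured disc -/

/-- Arcs, up to isotopy, of the once-punctured disc `S_n`, whose boundary vertices are `ZMod n`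
in counterclockwise order: `bridging v` joins `v` to the puncture; `peripheral v l` follows the
boundary counterclockwise from `v` over `l` boundary edges to `v + l`, the puncture being on its
other side.  For `l = 1` this would be a boundary edge, for `l = n` it is the loop at `v` around
the puncture, and for `l > n` such a curve crosses itself. -/
inductive PuncturedDiscArc (n : ℕ) : Type
  | bridging (v : ZMod n) : PuncturedDiscArc n
  | peripheral (v : ZMod n) (l : ℕ) (two_le : 2 ≤ l) (le_n : l ≤ n) : PuncturedDiscArc n

/-- The lifts of an arc to the infinite strip that is the universal cover of `S_n`.  The strip has
the vertices `ℤ` on its lower boundary, with covering map the reduction modulo `n`, and the lifts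
of the puncture are the one point `⊤ = +∞`, at which the asymptotic arcs meet. -/
def PuncturedDiscArc.IsLift {n : ℕ} : PuncturedDiscArc n → WithTop ℤ → WithTop ℤ → Prop
  | .bridging v, x, y => ∃ a : ℤ, (a : ZMod n) = v ∧ x = (a : WithTop ℤ) ∧ y = ⊤
  | .peripheral v l _ _, x, y =>
      ∃ a : ℤ, (a : ZMod n) = v ∧ x = (a : WithTop ℤ) ∧ y = ((a + l : ℤ) : WithTop ℤ)

/-- Two arcs cross if the endpoints of some lift of the one interlace with those of some lift of
the other.  (Stated with the lift of `α` starting on the left; use it for both orders.) -/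
def PuncturedDiscArc.Crosses {n : ℕ} (α β : PuncturedDiscArc n) : Prop :=
  ∃ x y z w : WithTop ℤ, α.IsLift x y ∧ β.IsLift z w ∧ x < z ∧ z < y ∧ y < w

/-- A dissection of `S_n`: a set of pairwise non-crossing arcs which divides `S_n` into polygons.
The regions cut out by non-crossing arcs that do not contain the puncture in their interior are
polygons, so the last requirement says that some arc ends at the puncture. -/
structure PuncturedDiscDissection (n : ℕ) where
  arcs : Set (PuncturedDiscArc n)
  noncrossing : ∀ α ∈ arcs, ∀ β ∈ arcs, ¬ α.Crosses β
  exists_bridging : ∃ v : ZMod n, PuncturedDiscArc.bridging v ∈ arcs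

namespace PuncturedDiscDissection

/-- The edges `x < y` of the lifted dissection of the strip: lifts of boundary edges and lifts of
arcs of the dissection. -/
def Edge {n : ℕ} (D : PuncturedDiscDissection n) (x y : WithTop ℤ) : Prop :=
  (∃ a : ℤ, x = (a : WithTop ℤ) ∧ y = ((a + 1 : ℤ) : WithTop ℤ)) ∨ ∃ α ∈ D.arcs, α.IsLift x y

/-- `Q` is the vertex set of a subgon of the lifted dissection: two vertices of `Q` are joined by
an edge exactly if they are cyclically adjacent in `Q` (so the sides of the polygon are edges and
none of its diagonals is an arc). -/
def IsSubgon {n : ℕ} (D : PuncturedDiscDissection n) (Q : Finset (WithTop ℤ)) : Prop :=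
  3 ≤ Q.card ∧ ∀ x ∈ Q, ∀ y ∈ Q, x < y →
    (D.Edge x y ↔ (¬ ∃ z ∈ Q, x < z ∧ z < y) ∨ ∀ z ∈ Q, x ≤ z ∧ z ≤ y)

/-- The subgons of the lifted dissection incident to the lift `i` of a boundary vertex.  They
correspond to the subgons of `S_n` met by a small half circle around the vertex, where a
self-folded subgon is counted once for each of its corners at the vertex. -/
def subgonsAt {n : ℕ} (D : PuncturedDiscDissection n) (i : ℤ) : Set (Finset (WithTop ℤ)) :=
  {Q | D.IsSubgon Q ∧ (i : WithTop ℤ) ∈ Q}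

theorem edge_bound {n : ℕ} [NeZero n] (D : PuncturedDiscDissection n) {a b : ℤ}
    (h : D.Edge (a : WithTop ℤ) (b : WithTop ℤ)) : b ≤ a + n := by
  have hn : 1 ≤ n := NeZero.one_le
  rcases h with ⟨c, h1, h2⟩ | ⟨α, -, hα⟩
  · have h1 := WithTop.coe_injective h1
    have h2 := WithTop.coe_injective h2
    omega
  · cases α with
    | bridging v =>
      obtain ⟨c, -, -, h2⟩ := hα
      exact absurd h2 (WithTop.coe_ne_top)
    | peripheral v l h2l hl =>
      obtain ⟨c, -, h1, h2⟩ := hα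
      have h1 := WithTop.coe_injective h1
      have h2 := WithTop.coe_injective h2
      omega

theorem subgon_bound {n : ℕ} [NeZero n] (D : PuncturedDiscDissection n)
    {Q : Finset (WithTop ℤ)} (hQ : D.IsSubgon Q) {i k : ℤ}
    (hi : (i : WithTop ℤ) ∈ Q) (hk : (k : WithTop ℤ) ∈ Q) : k ≤ i + n := by
  by_contra hlt
  push Not at hlt
  obtain ⟨-, hE⟩ := hQ
  have hn : 1 ≤ n := NeZero.one_le
  have hne : Q.Nonempty := ⟨_, hi⟩
  have hmin := Q.min'_mem hne
  have hminle : Q.min' hne ≤ (i : WithTop ℤ) := Q.min'_le _ hi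
  have hik : (i : WithTop ℤ) < (k : WithTop ℤ) := by
    apply WithTop.coe_lt_coe.2; omega
  obtain ⟨a, ha⟩ := WithTop.ne_top_iff_exists.1 (ne_top_of_le_ne_top WithTop.coe_ne_top hminle)
  have hai : a ≤ i := by rw [← ha] at hminle; exact WithTop.coe_le_coe.1 hminle
  by_cases htop : (⊤ : WithTop ℤ) ∈ Q
  · obtain ⟨v, hv⟩ := D.exists_bridging
    obtain ⟨t, hit, htn, htv⟩ : ∃ t : ℤ, i < t ∧ t ≤ i + n ∧ (t : ZMod n) = v := by
      refine ⟨i + 1 + ((v.val : ℤ) - (i + 1)) % n, ?_, ?_, ?_⟩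
      · have := Int.emod_nonneg ((v.val : ℤ) - (i + 1)) (b := (n : ℤ)) (by omega)
        omega
      · have := Int.emod_lt_of_pos ((v.val : ℤ) - (i + 1)) (b := (n : ℤ)) (by omega)
        omega
      · have h := (ZMod.intCast_mod ((v.val : ℤ) - (i + 1)) n)
        push_cast at h ⊢
        rw [h]
        simp
    have hti : (i : WithTop ℤ) < (t : WithTop ℤ) := WithTop.coe_lt_coe.2 hit
    have htk : (t : WithTop ℤ) < (k : WithTop ℤ) := WithTop.coe_lt_coe.2 (by omega)
    have hlift : (PuncturedDiscArc.bridging v).IsLift (t : WithTop ℤ) ⊤ := ⟨t, htv, rfl, rfl⟩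
    by_cases htQ : (t : WithTop ℤ) ∈ Q
    · rcases (hE _ htQ _ htop (WithTop.coe_lt_top t)).1 (Or.inr ⟨_, hv, hlift⟩) with h | h
      · exact h ⟨_, hk, htk, WithTop.coe_lt_top k⟩
      · exact absurd (h _ hi).1 (not_le.2 hti)
    · have hL : (Q.filter (· < (t : WithTop ℤ))).Nonempty := ⟨_, Finset.mem_filter.2 ⟨hi, hti⟩⟩
      have hR : (Q.filter ((t : WithTop ℤ) < ·)).Nonempty := ⟨_, Finset.mem_filter.2 ⟨hk, htk⟩⟩
      obtain ⟨c, hcQ, hct, hcmax⟩ : ∃ c ∈ Q, c < (t : WithTop ℤ) ∧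
          ∀ z ∈ Q.filter (· < (t : WithTop ℤ)), z ≤ c :=
        ⟨_, (Finset.mem_filter.1 (Finset.max'_mem _ hL)).1,
          (Finset.mem_filter.1 (Finset.max'_mem _ hL)).2, fun z hz => Finset.le_max' _ z hz⟩
      obtain ⟨d, hdQ, htd, hdmin⟩ : ∃ d ∈ Q, (t : WithTop ℤ) < d ∧
          ∀ z ∈ Q.filter ((t : WithTop ℤ) < ·), d ≤ z :=
        ⟨_, (Finset.mem_filter.1 (Finset.min'_mem _ hR)).1,
          (Finset.mem_filter.1 (Finset.min'_mem _ hR)).2, fun z hz => Finset.min'_le _ z hz⟩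
      have hdk : d ≤ (k : WithTop ℤ) := hdmin _ (Finset.mem_filter.2 ⟨hk, htk⟩)
      have hdt : d < ⊤ := lt_of_le_of_lt hdk (WithTop.coe_lt_top k)
      have hedge : D.Edge c d := by
        refine (hE _ hcQ _ hdQ (hct.trans htd)).2 (Or.inl ?_)
        rintro ⟨z, hz, h1, h2⟩
        rcases lt_trichotomy z (t : WithTop ℤ) with h | h | h
        · exact absurd (hcmax _ (Finset.mem_filter.2 ⟨hz, h⟩)) (not_le.2 h1)
        · exact htQ (h ▸ hz)
        · exact absurd (hdmin _ (Finset.mem_filter.2 ⟨hz, h⟩)) (not_le.2 h2)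
      rcases hedge with ⟨e, h1, h2⟩ | ⟨α, hα, hl⟩
      · rw [h1] at hct
        rw [h2] at htd
        have := WithTop.coe_lt_coe.1 hct
        have := WithTop.coe_lt_coe.1 htd
        omega
      · exact D.noncrossing _ hα _ hv ⟨c, d, t, ⊤, hl, hlift, hct, htd, hdt⟩
  · have hmax := Q.max'_mem hne
    have hkle : (k : WithTop ℤ) ≤ Q.max' hne := Q.le_max' _ hk
    obtain ⟨b, hb⟩ := WithTop.ne_top_iff_exists.1
      (show Q.max' hne ≠ ⊤ from fun h => htop (h ▸ hmax))
    have hkb : k ≤ b := by rw [← hb] at hkle; exact WithTop.coe_le_coe.1 hkle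
    have hedge := (hE _ hmin _ hmax (lt_of_le_of_lt hminle (lt_of_lt_of_le hik hkle))).2
      (Or.inr fun z hz => ⟨Q.min'_le _ hz, Q.le_max' _ hz⟩)
    rw [← ha, ← hb] at hedge
    have := D.edge_bound hedge
    omega

theorem subgonsAt_finite {n : ℕ} [NeZero n] (D : PuncturedDiscDissection n) (i : ℤ) :
    (D.subgonsAt i).Finite := by
  classical
  refine Set.Finite.subset (Finset.finite_toSet
    (insert (⊤ : WithTop ℤ) ((Finset.Icc (i - n) (i + n)).image
      fun k : ℤ => (k : WithTop ℤ))).powerset) ?_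
  rintro Q ⟨hQ, hi⟩
  rw [Finset.mem_coe, Finset.mem_powerset]
  intro x hx
  induction x using WithTop.recTopCoe with
  | top => exact Finset.mem_insert_self _ _
  | coe k =>
    refine Finset.mem_insert_of_mem (Finset.mem_image.2 ⟨k, Finset.mem_Icc.2 ⟨?_, ?_⟩, rfl⟩)
    · have := D.subgon_bound hQ hx hi
      omega
    · exact D.subgon_bound hQ hi hx

/-- The multiset `A_i` of sizes of the subgons incident to the vertex `v_i`. -/
def sizesAt {n : ℕ} [NeZero n] (D : PuncturedDiscDissection n) (i : ℤ) : Multiset ℕ :=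
  (D.subgonsAt_finite i).toFinset.val.map Finset.card

end PuncturedDiscDissection

/-- The frieze pattern is realizable by a dissection of the once-punctured disc `S_n`. -/
def InfiniteFrieze.RealizableOnPuncturedDisc (F : InfiniteFrieze ℝ) (n : ℕ) [NeZero n] : Prop :=
  ∃ D : PuncturedDiscDissection n, ∀ i : ℤ, F.quiddity i = lambdaSum (D.sizesAt i)

end

/-! A quiddity sequence `a` is read as the recurrence `x (i - 1) + x (i + 1) = a i * x i`. When the
continuants of this recurrence are positive, they are the frieze entries, and the first growth
coefficient is the trace of the monodromy over one period. That matrix has determinant 1, so trace 2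
means exactly that 1 is an eigenvalue.

For a dissection all of whose arcs end at the puncture, make every subgon a regular polygon with
unit sides. The λ-lengths `f i` from the vertices to the puncture then form a positive periodic
solution of the recurrence given by the dissection's quiddity (`punctureLength_recurrence`).

If the frieze is realizable, the skeletal condition excludes peripheral arcs, since a shortest one
cuts off a run of `λ_p` that is too long. Hence `f` yields a fixed vector of the monodromy and the
trace is 2.

Conversely, the criteria produce a bridging dissection whose quiddity is at most that of the frieze,
entry by entry (`exists_block_le`), so its `f` is a supersolution. If the trace is 2, there is a
periodic solution `g`, and a maximum principle for `g / f` forces `f` to be a solution. As `f` is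
positive, the two quiddities coincide. -/

noncomputable section

/-! ### Continuants and the entries of a frieze -/

/-- The solution of `x (j - 1) + x (j + 1) = a j * x j` with `x i = 0` and `x (i + 1) = 1`,
evaluated at `i + k`. -/
def continuant (a : ℤ → ℝ) (i : ℤ) : ℕ → ℝ
  | 0 => 0
  | 1 => 1
  | k + 2 => a (i + k + 1) * continuant a i (k + 1) - continuant a i k

theorem continuant_add_two (a : ℤ → ℝ) (i : ℤ) (k : ℕ) :
    continuant a i (k + 2) = a (i + k + 1) * continuant a i (k + 1) - continuant a i k := by
  rw [continuant]

/-- The Wronskian of two solutions is constant. Applied over a period, this says that the monodromy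
has determinant 1. -/
theorem continuant_wronskian (a : ℤ → ℝ) (i : ℤ) (k : ℕ) :
    continuant a i (k + 1) * continuant a (i + 1) (k + 1) -
      continuant a (i + 1) k * continuant a i (k + 2) = 1 := by
  induction k with
  | zero => simp [continuant]
  | succ k ih =>
    have h1 := continuant_add_two a i (k + 1)
    have h2 := continuant_add_two a (i + 1) k
    have h3 : i + 1 + (k : ℤ) + 1 = i + ((k + 1 : ℕ) : ℤ) + 1 := by push_cast; ring
    rw [h3] at h2
    rw [h1, h2]
    linear_combination ih

/-- Sturm comparison: the Wronskian of the continuant with a positive supersolution `f` starts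
positive and does not decrease, so the continuant cannot return to zero. -/
theorem continuant_pos {a f : ℤ → ℝ} (hf : ∀ i, 0 < f i)
    (hfa : ∀ i, f (i - 1) + f (i + 1) ≤ a i * f i) (i : ℤ) (k : ℕ) :
    0 < continuant a i (k + 1) := by
  have key : 0 ≤ continuant a i k ∧ 0 < continuant a i (k + 1) ∧
      0 < continuant a i (k + 1) * f (i + k) - continuant a i k * f (i + k + 1) := by
    induction k with
    | zero => simp [continuant, hf]
    | succ k ih =>
      obtain ⟨h0, h1, hW⟩ := ih
      have hW' : 0 < continuant a i (k + 2) * f (i + k + 1) -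
          continuant a i (k + 1) * f (i + k + 1 + 1) := by
        have h := mul_le_mul_of_nonneg_left (hfa (i + k + 1)) h1.le
        rw [add_sub_cancel_right] at h
        rw [continuant_add_two]
        linarith
      have h2 : 0 < continuant a i (k + 2) := by
        have h : 0 < continuant a i (k + 2) * f (i + k + 1) := by
          have := mul_pos h1 (hf (i + k + 1 + 1))
          linarith
        exact pos_of_mul_pos_left h (hf _).le
      refine ⟨h1.le, h2, ?_⟩
      have h3 : i + ((k + 1 : ℕ) : ℤ) = i + k + 1 := by push_cast; ring
      rw [h3]
      exact hW'
  exact key.2.1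

/-- The unimodular rule determines each row from the two before it, as long as one may divide by the
entry of the earlier row. The continuants obey the same rule, and their positivity permits the
division. -/
theorem InfiniteFrieze.m_eq_continuant (F : InfiniteFrieze ℝ)
    (hpos : ∀ i k, 0 < continuant F.quiddity i (k + 1)) (k : ℕ) (i : ℤ) :
    F.m i (i + k) = continuant F.quiddity i k := by
  have key : (∀ i : ℤ, F.m i (i + k) = continuant F.quiddity i k) ∧
      ∀ i : ℤ, F.m i (i + k + 1) = continuant F.quiddity i (k + 1) := by
    induction k with
    | zero => simp [continuant, F.diag_zero, F.diag_one]
    | succ k ih =>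
      obtain ⟨h0, h1⟩ := ih
      have hcast (i : ℤ) : i + ((k + 1 : ℕ) : ℤ) = i + k + 1 := by push_cast; ring
      refine ⟨fun i => by rw [hcast]; exact h1 i, fun i => ?_⟩
      rw [hcast]
      cases k with
      | zero =>
        have : F.quiddity (i + 1) = F.m i (i + 1 + 1) := by simp [quiddity]
        simp [continuant, this]
      | succ k =>
        have hu := F.unimodular (i + 1) (i + 1 + ((k + 1 : ℕ) : ℤ)) (by omega)
        have hw := continuant_wronskian F.quiddity i (k + 1)
        rw [h0, h1, add_sub_cancel_right,
          show i + 1 + ((k + 1 : ℕ) : ℤ) = i + ((k + 1 : ℕ) : ℤ) + 1 by ring, h1] at hu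
        have hne := (hpos (i + 1) k).ne'
        apply mul_left_cancel₀ hne
        linarith
  exact key.1 i

/-- The right-hand side is the trace of the monodromy over a period of length `N + 1`. -/
theorem InfiniteFrieze.growthCoeff_one_eq (F : InfiniteFrieze ℝ)
    (hpos : ∀ i k, 0 < continuant F.quiddity i (k + 1)) (N : ℕ) :
    F.growthCoeff (N + 1) 1 =
      continuant F.quiddity 0 (N + 2) - continuant F.quiddity 1 N := by
  rw [← F.m_eq_continuant hpos, ← F.m_eq_continuant hpos, growthCoeff]
  congr 2 <;> push_cast <;> ring

theorem eq_continuant_of_solution {a g : ℤ → ℝ}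
    (hg : ∀ i, g (i - 1) + g (i + 1) = a i * g i) (k : ℕ) :
    g (k + 1) = g 1 * continuant a 0 (k + 1) - g 0 * continuant a 1 k := by
  induction k using Nat.strong_induction_on with
  | _ k ih =>
    match k with
    | 0 => simp [continuant]
    | 1 =>
      have := hg 1
      norm_num at this ⊢
      simp [continuant]
      linarith
    | k + 2 =>
      have h0 := ih k (by omega)
      have h1 := ih (k + 1) (by omega)
      have h := hg (k + 2)
      have e1 : (((k + 1 : ℕ) : ℤ) + 1) = (k : ℤ) + 2 := by push_cast; ring
      have e2 : (((k + 2 : ℕ) : ℤ) + 1) = (k : ℤ) + 2 + 1 := by push_cast; ring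
      have e3 : (k : ℤ) + 2 - 1 = k + 1 := by ring
      have e4 : (0 : ℤ) + ((k + 1 : ℕ) : ℤ) + 1 = (k : ℤ) + 2 := by push_cast; ring
      have e5 : (1 : ℤ) + (k : ℤ) + 1 = (k : ℤ) + 2 := by ring
      rw [e1] at h1
      rw [e3, h0, h1] at h
      have c1 := continuant_add_two a 0 (k + 1)
      have c2 := continuant_add_two a 1 k
      rw [e4] at c1
      rw [e5] at c2
      rw [e2, c1, c2]
      linear_combination h

/-! ### Periodic solutions and growth coefficient 2 -/

/-- A periodic solution of the recurrence of the frieze forces its first growth coefficient to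
be `2`. -/
theorem InfiniteFrieze.growthCoeff_eq_two_of_solution (F : InfiniteFrieze ℝ) (n : ℕ) [NeZero n]
    {f : ℤ → ℝ} (hf : ∀ i, 0 < f i) (hper : ∀ i, f (i + n) = f i)
    (hsol : ∀ i, f (i - 1) + f (i + 1) = F.quiddity i * f i) : F.growthCoeff n 1 = 2 := by
  obtain ⟨N, rfl⟩ := Nat.exists_eq_succ_of_ne_zero (NeZero.ne n)
  have hpos := continuant_pos hf fun i => (hsol i).le
  rw [Nat.succ_eq_add_one, F.growthCoeff_one_eq hpos]
  have h0 := eq_continuant_of_solution hsol N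
  have h1 := eq_continuant_of_solution hsol (N + 1)
  have p0 := hper 0
  have p1 := hper 1
  rw [show (0 : ℤ) + ((N.succ : ℕ) : ℤ) = N + 1 by push_cast; ring] at p0
  rw [show (1 : ℤ) + ((N.succ : ℕ) : ℤ) = ((N + 1 : ℕ) : ℤ) + 1 by push_cast; ring] at p1
  rw [p0] at h0
  rw [p1] at h1
  have hw := continuant_wronskian F.quiddity 0 N
  rw [zero_add] at hw
  set x := continuant F.quiddity 0 (N + 1)
  set x' := continuant F.quiddity 0 (N + 2)
  set y := continuant F.quiddity 1 N
  set y' := continuant F.quiddity 1 (N + 1)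
  have h0' := hf 0
  -- This is the characteristic polynomial of the monodromy at 1, applied to the fixed vector `(f 0,
  -- f 1)`, with `hw` supplying the determinant.
  have : f 0 * (x' - y - 2) = 0 := by
    linear_combination (x' - 1) * h0 - x * h1 + f 0 * hw
  rcases mul_eq_zero.1 this with h | h <;> linarith

/-- If the first growth coefficient is `2`, a positive periodic supersolution of the recurrence
is a solution. -/
theorem InfiniteFrieze.solution_of_growthCoeff_eq_two (F : InfiniteFrieze ℝ) (n : ℕ) [NeZero n]
    (hF : F.IsPeriodic n) {f : ℤ → ℝ} (hf : ∀ i, 0 < f i) (hper : ∀ i, f (i + n) = f i)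
    (hsup : ∀ i, f (i - 1) + f (i + 1) ≤ F.quiddity i * f i) (h2 : F.growthCoeff n 1 = 2)
    (i : ℤ) : f (i - 1) + f (i + 1) = F.quiddity i * f i := by
  obtain ⟨N, rfl⟩ := Nat.exists_eq_succ_of_ne_zero (NeZero.ne n)
  have hpos := continuant_pos hf hsup
  rw [Nat.succ_eq_add_one, F.growthCoeff_one_eq hpos] at h2
  set x := continuant F.quiddity 0 with hx
  set y := continuant F.quiddity 1 with hy
  have hw : x (N + 1) * y (N + 1) - y N * x (N + 2) = 1 := by
    simpa using continuant_wronskian F.quiddity 0 N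
  -- `g` is the solution with `g 0 = x (N + 1)` and `g 1 = y N + 1`, an eigenvector of the monodromy
  -- for the eigenvalue 1. Its first coordinate is positive, which will make the maximum of `g / f`
  -- positive.
  let g : ℕ → ℝ := fun k => match k with
    | 0 => x (N + 1)
    | k + 1 => (y N + 1) * x (k + 1) - x (N + 1) * y k
  have g0 : g 0 = x (N + 1) := rfl
  have gs (k : ℕ) : g (k + 1) = (y N + 1) * x (k + 1) - x (N + 1) * y k := rfl
  have grec (k : ℕ) : g k + g (k + 2) = F.quiddity (k + 1) * g (k + 1) := by
    cases k with
    | zero =>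
      rw [g0, gs, gs, hx, hy, continuant_add_two]
      simp [continuant]
      ring
    | succ k =>
      rw [gs, gs, gs, hx, hy, continuant_add_two _ 0 (k + 1), continuant_add_two _ 1 k]
      rw [show (0 : ℤ) + ((k + 1 : ℕ) : ℤ) + 1 = ((k + 1 : ℕ) : ℤ) + 1 by ring,
        show (1 : ℤ) + (k : ℤ) + 1 = ((k + 1 : ℕ) : ℤ) + 1 by push_cast; ring]
      ring
  have gN : g (N + 1) = g 0 := by rw [gs, g0]; ring
  have gN1 : g (N + 2) = g 1 := by
    have x1 : x (0 + 1) = 1 := rfl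
    have y0 : y 0 = 0 := rfl
    rw [gs, show g 1 = _ from gs 0, x1, y0]
    linear_combination (-(1 : ℝ)) * hw + h2
  -- One full period suffices: the bound `g ≤ c * f` extends to 0 and `N + 2` by periodicity.
  obtain ⟨j, hj, hjmax⟩ := Finset.exists_max_image (Finset.Icc 1 (N + 1))
    (fun k : ℕ => g k / f k) ⟨1, by simp⟩
  set c := g j / f j with hc
  have fN : f ((N + 1 : ℕ) : ℤ) = f ((0 : ℕ) : ℤ) := by simpa using hper 0
  have fN1 : f ((N + 2 : ℕ) : ℤ) = f ((1 : ℕ) : ℤ) := by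
    have := hper 1
    rw [show (1 : ℤ) + ((N.succ : ℕ) : ℤ) = ((N + 2 : ℕ) : ℤ) by push_cast; ring] at this
    simpa using this
  have hle (k : ℕ) (hk : k ≤ N + 2) : g k ≤ c * f k := by
    rw [← div_le_iff₀ (hf _)]
    rcases Nat.eq_zero_or_pos k with rfl | h
    · have := hjmax (N + 1) (by simp)
      rwa [gN, fN] at this
    · rcases eq_or_lt_of_le hk with rfl | h'
      · have := hjmax 1 (by simp)
        rwa [gN1, fN1]
      · exact hjmax k (Finset.mem_Icc.2 ⟨h, by omega⟩)
  have hcpos : 0 < c := by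
    have h := hle 0 (by omega)
    rw [g0] at h
    exact pos_of_mul_pos_left ((hpos 0 N).trans_le h) (hf _).le
  -- Maximum principle: if `c * f - g ≥ 0` vanishes at a point, the supersolution inequality forces
  -- it to vanish at both neighbours and `f` to satisfy the recurrence there with equality.
  have step (k : ℕ) (hk : k ≤ N) (h : g (k + 1) = c * f ((k + 1 : ℕ) : ℤ)) :
      g k = c * f k ∧ g (k + 2) = c * f ((k + 2 : ℕ) : ℤ) ∧
      f (k : ℤ) + f ((k + 2 : ℕ) : ℤ) = F.quiddity (k + 1) * f ((k + 1 : ℕ) : ℤ) := by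
    have l0 := hle k (by omega)
    have l2 := hle (k + 2) (by omega)
    have hs := hsup (k + 1)
    rw [add_sub_cancel_right, show (k : ℤ) + 1 + 1 = ((k + 2 : ℕ) : ℤ) by push_cast; ring] at hs
    have hr := grec k
    rw [h] at hr
    push_cast at *
    have hs' := mul_le_mul_of_nonneg_left hs hcpos.le
    refine ⟨by linarith, by linarith, ?_⟩
    apply mul_left_cancel₀ hcpos.ne'
    linarith
  have hj1 := Finset.mem_Icc.1 hj
  have hgj : g j = c * f j := by rw [hc, div_mul_cancel₀ _ (hf _).ne']
  have up (k : ℕ) (hk : j ≤ k) : k ≤ N + 1 → g k = c * f k := by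
    induction k, hk using Nat.le_induction with
    | base => exact fun _ => hgj
    | succ k hjk ih =>
      intro hk
      obtain ⟨l, rfl⟩ : ∃ l, k = l + 1 := ⟨k - 1, by omega⟩
      exact (step l (by omega) (ih (by omega))).2.1
  -- Contact has spread from `j` up to `N + 1`; from there it spreads down over the whole period.
  have down (d : ℕ) : ∀ k, k + d = N + 1 → g k = c * f k := by
    induction d with
    | zero => intro k hk; exact up k (by omega) (by omega)
    | succ d ih => intro k hk; exact (step k (by omega) (ih (k + 1) (by omega))).1
  have hall (k : ℕ) (hk : k ≤ N) :
      f (k : ℤ) + f (k + 2) = F.quiddity (k + 1) * f (k + 1) := by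
    have := (step k hk (down (N - k) (k + 1) (by omega))).2.2
    push_cast at this
    exact this
  have shift {φ : ℤ → ℝ} (hφ : ∀ i, φ (i + (N.succ : ℕ)) = φ i) (i : ℤ) (t : ℤ) :
      φ (i + t * (N.succ : ℕ)) = φ i := by
    have : Function.Periodic φ ((N.succ : ℕ) : ℤ) := hφ
    simpa using this.int_mul t i
  set r := (i - 1) % ((N.succ : ℕ) : ℤ) with hr
  set t := (i - 1) / ((N.succ : ℕ) : ℤ) with ht
  have hi : i - 1 = r + t * (N.succ : ℕ) := by
    rw [hr, ht, mul_comm, add_comm]; exact (Int.mul_ediv_add_emod _ _).symm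
  have hr0 : 0 ≤ r := Int.emod_nonneg _ (by positivity)
  have hr1 : r < (N.succ : ℕ) := Int.emod_lt_of_pos _ (by positivity)
  obtain ⟨k, hk⟩ := Int.eq_ofNat_of_zero_le hr0
  have := hall k (by omega)
  rw [← hk] at this
  rw [hi, show i + 1 = r + 2 + t * (N.succ : ℕ) by linarith,
    show F.quiddity i = F.quiddity (r + 1) by rw [← shift hF (r + 1) t]; congr 1; linarith,
    show f i = f (r + 1) by rw [← shift hper (r + 1) t]; congr 1; linarith,
    shift hper, shift hper]
  exact this

/-! ### Blocks between consecutive elements of a periodic set -/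

/-- `lo i` and `hi i` are the consecutive elements of `B` with `lo i ≤ i < hi i`. -/
structure IsBlockDecomposition (B : Set ℤ) (lo hi : ℤ → ℤ) : Prop where
  lo_mem : ∀ i, lo i ∈ B
  hi_mem : ∀ i, hi i ∈ B
  lo_le : ∀ i, lo i ≤ i
  lt_hi : ∀ i, i < hi i
  not_mem : ∀ i j, lo i < j → j < hi i → j ∉ B

theorem exists_isBlockDecomposition {B : Set ℤ} {n : ℕ} [NeZero n]
    (hB : ∀ i : ℤ, i + n ∈ B ↔ i ∈ B) (hne : B.Nonempty) :
    ∃ lo hi, IsBlockDecomposition B lo hi := by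
  have hn : (1 : ℤ) ≤ n := by exact_mod_cast NeZero.one_le (n := n)
  obtain ⟨b, hb⟩ := hne
  have hper : Function.Periodic (fun i => i ∈ B) (n : ℤ) := fun i => propext (hB i)
  have hmul (t : ℤ) : b + t * n ∈ B := by
    have := hper.int_mul t b
    exact this.mpr hb
  -- Periodicity makes `B` unbounded on both sides; the multiples of `n` below are merely large
  -- enough.
  have hlo (i : ℤ) : ∃ l, (l ∈ B ∧ l ≤ i) ∧ ∀ z, z ∈ B ∧ z ≤ i → z ≤ l := by
    refine Int.exists_greatest_of_bdd ⟨i, fun z hz => hz.2⟩ ⟨b + (-(|b| + |i|)) * n, hmul _, ?_⟩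
    nlinarith [le_abs_self b, neg_abs_le i, abs_nonneg b, abs_nonneg i]
  have hhi (i : ℤ) : ∃ h, (h ∈ B ∧ i < h) ∧ ∀ z, z ∈ B ∧ i < z → h ≤ z := by
    refine Int.exists_least_of_bdd ⟨i, fun z hz => hz.2.le⟩
      ⟨b + (|b| + |i| + 1) * n, hmul _, ?_⟩
    nlinarith [neg_abs_le b, le_abs_self i, abs_nonneg b, abs_nonneg i]
  choose lo hlo using hlo
  choose hi hhi using hhi
  refine ⟨lo, hi, fun i => (hlo i).1.1, fun i => (hhi i).1.1, fun i => (hlo i).1.2,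
    fun i => (hhi i).1.2, fun i j h1 h2 hj => ?_⟩
  rcases le_or_gt j i with h | h
  · exact absurd ((hlo i).2 j ⟨hj, h⟩) (not_le.2 h1)
  · exact absurd ((hhi i).2 j ⟨hj, h⟩) (not_le.2 h2)

namespace IsBlockDecomposition

variable {B : Set ℤ} {lo hi : ℤ → ℤ}

theorem unique (h : IsBlockDecomposition B lo hi) {i b c : ℤ} (hb : b ∈ B) (hc : c ∈ B)
    (hbi : b ≤ i) (hic : i < c) (hbc : ∀ j, b < j → j < c → j ∉ B) : lo i = b ∧ hi i = c := by
  constructor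
  · rcases lt_trichotomy (lo i) b with h1 | h1 | h1
    · exact absurd hb (h.not_mem i b h1 (hbi.trans_lt (h.lt_hi i)))
    · exact h1
    · exact absurd (h.lo_mem i) (hbc _ h1 ((h.lo_le i).trans_lt hic))
  · rcases lt_trichotomy (hi i) c with h1 | h1 | h1
    · exact absurd (h.hi_mem i) (hbc _ (hbi.trans_lt (h.lt_hi i)) h1)
    · exact h1
    · exact absurd hc (h.not_mem i c ((h.lo_le i).trans_lt hic) h1)

theorem eq_of_mem_Ico (h : IsBlockDecomposition B lo hi) {i j : ℤ} (h1 : lo i ≤ j)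
    (h2 : j < hi i) : lo j = lo i ∧ hi j = hi i :=
  h.unique (h.lo_mem i) (h.hi_mem i) h1 h2 (h.not_mem i)

theorem lo_of_mem (h : IsBlockDecomposition B lo hi) {i : ℤ} (hi' : i ∈ B) : lo i = i := by
  rcases (h.lo_le i).lt_or_eq with h1 | h1
  · exact absurd hi' (h.not_mem i i h1 (h.lt_hi i))
  · exact h1

theorem hi_pred_of_mem (h : IsBlockDecomposition B lo hi) {i : ℤ} (hi' : i ∈ B) :
    hi (i - 1) = i := by
  have h1 := h.lt_hi (i - 1)
  have h2 := h.lo_le (i - 1)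
  by_contra hne
  exact h.not_mem (i - 1) i (by omega) (by omega) hi'

theorem lo_lt_of_notMem (h : IsBlockDecomposition B lo hi) {i : ℤ} (hi' : i ∉ B) : lo i < i :=
  (h.lo_le i).lt_of_ne fun e => hi' (e ▸ h.lo_mem i)

theorem pred_of_notMem (h : IsBlockDecomposition B lo hi) {i : ℤ} (hi' : i ∉ B) :
    lo (i - 1) = lo i ∧ hi (i - 1) = hi i := by
  have h1 := h.lo_lt_of_notMem hi'
  have h2 := h.lt_hi i
  exact h.eq_of_mem_Ico (by omega) (by omega)

theorem add_period (h : IsBlockDecomposition B lo hi) {n : ℕ} (hB : ∀ i : ℤ, i + n ∈ B ↔ i ∈ B)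
    (i : ℤ) : lo (i + n) = lo i + n ∧ hi (i + n) = hi i + n := by
  refine h.unique ((hB _).2 (h.lo_mem i)) ((hB _).2 (h.hi_mem i)) ?_ ?_ fun j h1 h2 hj => ?_
  · have := h.lo_le i
    omega
  · have := h.lt_hi i
    omega
  · refine h.not_mem i (j - n) (by omega) (by omega) ((hB _).1 ?_)
    rwa [sub_add_cancel]

end IsBlockDecomposition

/-! ### λ-lengths from the boundary to the puncture -/

theorem Real.sin_mul_pi_div_pos {N : ℕ} {t : ℝ} (h0 : 0 < t) (ht : t < N) :
    0 < Real.sin (t * (Real.pi / N)) := by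
  have hN : (0 : ℝ) < N := h0.trans ht
  apply Real.sin_pos_of_pos_of_lt_pi
  · have := Real.pi_pos
    positivity
  · rw [mul_div_assoc', div_lt_iff₀ hN, mul_comm]
    exact mul_lt_mul_of_pos_left ht Real.pi_pos

/-- The number of sides of the subgon over the boundary edge from `i` to `i + 1`, when its
vertices are `lo i, …, hi i` and the puncture. -/
def blockSize (lo hi : ℤ → ℤ) (i : ℤ) : ℕ := (hi i - lo i + 2).toNat

open Classical in
/-- The sizes of the subgons at `i` if all arcs are bridging and end at the vertices in `B`. -/
def blockSizes (B : Set ℤ) (lo hi : ℤ → ℤ) (i : ℤ) : Multiset ℕ :=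
  if i ∈ B then {blockSize lo hi (i - 1), blockSize lo hi i} else {blockSize lo hi i}

/-- The `λ`-length of the segment from `i` to the puncture, when all subgons are regular. -/
def punctureLength (lo hi : ℤ → ℤ) (i : ℤ) : ℝ :=
  Real.sin ((i - lo i + 1) * (Real.pi / blockSize lo hi i)) /
    Real.sin (Real.pi / blockSize lo hi i)

namespace IsBlockDecomposition

variable {B : Set ℤ} {lo hi : ℤ → ℤ}

theorem cast_blockSize (h : IsBlockDecomposition B lo hi) (i : ℤ) :
    (blockSize lo hi i : ℤ) = hi i - lo i + 2 := by
  have := h.lo_le i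
  have := h.lt_hi i
  unfold blockSize
  omega

theorem three_le_blockSize (h : IsBlockDecomposition B lo hi) (i : ℤ) :
    3 ≤ blockSize lo hi i := by
  have := h.lo_le i
  have := h.lt_hi i
  have := h.cast_blockSize i
  omega

theorem sin_pos (h : IsBlockDecomposition B lo hi) (i : ℤ) :
    0 < Real.sin (Real.pi / blockSize lo hi i) := by
  have h3 : (3 : ℝ) ≤ blockSize lo hi i := by exact_mod_cast h.three_le_blockSize i
  simpa using Real.sin_mul_pi_div_pos one_pos (show (1 : ℝ) < blockSize lo hi i by linarith)

theorem punctureLength_pos (h : IsBlockDecomposition B lo hi) (i : ℤ) :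
    0 < punctureLength lo hi i := by
  have h1 := h.lo_le i
  have h2 := h.lt_hi i
  have h3 := h.cast_blockSize i
  refine div_pos (Real.sin_mul_pi_div_pos ?_ ?_) (h.sin_pos i)
  · have : (0 : ℝ) < ((i - lo i + 1 : ℤ) : ℝ) := by exact_mod_cast (by omega)
    push_cast at this
    exact this
  · have : ((i - lo i + 1 : ℤ) : ℝ) < ((blockSize lo hi i : ℤ) : ℝ) := by exact_mod_cast (by omega)
    push_cast at this
    exact this

theorem punctureLength_of_mem (h : IsBlockDecomposition B lo hi) {i : ℤ} (hi' : i ∈ B) :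
    punctureLength lo hi i = 1 := by
  simp [punctureLength, h.lo_of_mem hi', (h.sin_pos i).ne']

/-- On a whole block, including its right end, `punctureLength` is given by one formula. -/
theorem punctureLength_eq (h : IsBlockDecomposition B lo hi) {i j : ℤ} (h1 : lo i ≤ j)
    (h2 : j ≤ hi i) : punctureLength lo hi j =
      Real.sin ((j - lo i + 1) * (Real.pi / blockSize lo hi i)) /
        Real.sin (Real.pi / blockSize lo hi i) := by
  rcases h2.lt_or_eq with h2 | rfl
  · have := h.eq_of_mem_Ico h1 h2
    simp [punctureLength, blockSize, this]
  · have hN : (blockSize lo hi i : ℝ) = hi i - lo i + 2 := by exact_mod_cast h.cast_blockSize i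
    have hN0 : (blockSize lo hi i : ℝ) ≠ 0 := by
      have := h.three_le_blockSize i
      positivity
    -- The right end is assigned to the next block by `lo` and `hi`. The formulas of both blocks
    -- give 1 there, because it is adjacent to the puncture in either polygon.
    have hang : ((hi i : ℝ) - lo i + 1) * (Real.pi / blockSize lo hi i) =
        Real.pi - Real.pi / blockSize lo hi i := by
      rw [show (hi i : ℝ) - lo i + 1 = blockSize lo hi i - 1 by rw [hN]; ring]
      field_simp
    rw [h.punctureLength_of_mem (h.hi_mem i), hang, Real.sin_pi_sub, div_self (h.sin_pos i).ne']

theorem punctureLength_add_period (h : IsBlockDecomposition B lo hi) {n : ℕ}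
    (hB : ∀ i : ℤ, i + n ∈ B ↔ i ∈ B) (i : ℤ) :
    punctureLength lo hi (i + n) = punctureLength lo hi i := by
  obtain ⟨h1, h2⟩ := h.add_period hB i
  have h3 : blockSize lo hi (i + n) = blockSize lo hi i := by
    simp [blockSize, h1, h2]
  rw [punctureLength, punctureLength, h3, h1]
  push_cast
  simp

/-- Inside a block this is `sin (t - θ) + sin (t + θ) = 2 cos θ sin t`. At a point of `B` the length
is 1, and each neighbour contributes `sin 2θ / sin θ = 2 cos θ` for its own block. -/
theorem punctureLength_recurrence (h : IsBlockDecomposition B lo hi) (i : ℤ) :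
    punctureLength lo hi (i - 1) + punctureLength lo hi (i + 1) =
      lambdaSum (blockSizes B lo hi i) * punctureLength lo hi i := by
  have hlo := h.lo_le i
  have hhi := h.lt_hi i
  have hs := (h.sin_pos i).ne'
  have hR := h.punctureLength_eq (i := i) (j := i + 1) (by omega) (by omega)
  by_cases hB : i ∈ B
  · have h1 := h.hi_pred_of_mem hB
    have h2 := h.lo_le (i - 1)
    have hL := h.punctureLength_eq (i := i - 1) (j := i - 1) (by omega) (by omega)
    have hs' := (h.sin_pos (i - 1)).ne'
    have hN : (blockSize lo hi (i - 1) : ℝ) = hi (i - 1) - lo (i - 1) + 2 := by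
      exact_mod_cast h.cast_blockSize (i - 1)
    have hN0 : (blockSize lo hi (i - 1) : ℝ) ≠ 0 := by
      have := h.three_le_blockSize (i - 1)
      positivity
    have hang : (((i - 1 : ℤ) : ℝ) - lo (i - 1) + 1) * (Real.pi / blockSize lo hi (i - 1)) =
        Real.pi - 2 * (Real.pi / blockSize lo hi (i - 1)) := by
      rw [show ((i - 1 : ℤ) : ℝ) - lo (i - 1) + 1 = blockSize lo hi (i - 1) - 2 by
        rw [hN, h1]; push_cast; ring]
      field_simp
    have hang' : (((i + 1 : ℤ) : ℝ) - lo i + 1) = 2 := by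
      rw [h.lo_of_mem hB]; push_cast; ring
    rw [hang, Real.sin_pi_sub, Real.sin_two_mul] at hL
    rw [hang', Real.sin_two_mul] at hR
    rw [hL, hR, h.punctureLength_of_mem hB]
    simp [blockSizes, hB, lambdaSum, friezeLambda]
    field_simp
  · obtain ⟨h1, h2⟩ := h.pred_of_notMem hB
    have h3 := h.lo_lt_of_notMem hB
    have hL := h.punctureLength_eq (i := i) (j := i - 1) (by omega) (by omega)
    rw [hL, hR, punctureLength]
    simp only [blockSizes, hB, lambdaSum, friezeLambda, if_false, Multiset.map_singleton,
      Multiset.sum_singleton]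
    set θ := Real.pi / blockSize lo hi i
    rw [show (((i - 1 : ℤ) : ℝ) - lo i + 1) * θ = ((i : ℝ) - lo i + 1) * θ - θ by
        push_cast; ring,
      show (((i + 1 : ℤ) : ℝ) - lo i + 1) * θ = ((i : ℝ) - lo i + 1) * θ + θ by
        push_cast; ring, Real.sin_sub, Real.sin_add]
    ring

end IsBlockDecomposition

/-! ### A bridging dissection dominated by the skeletal criteria -/

theorem friezeLambda_le {p q : ℕ} (hp : 1 ≤ p) (hpq : p ≤ q) : friezeLambda p ≤ friezeLambda q := by
  have hp' : (1 : ℝ) ≤ p := by exact_mod_cast hp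
  have hpq' : (p : ℝ) ≤ q := by exact_mod_cast hpq
  have hpi := Real.pi_pos
  unfold friezeLambda
  refine mul_le_mul_of_nonneg_left (Real.cos_le_cos_of_nonneg_of_le_pi (by positivity) ?_ ?_)
    two_pos.le
  · exact div_le_self hpi.le hp'
  · exact div_le_div_of_nonneg_left hpi.le (by linarith) hpq'

theorem friezeLambda_lt_two {p : ℕ} (hp : 1 ≤ p) : friezeLambda p < 2 := by
  have hp' : (1 : ℝ) ≤ p := by exact_mod_cast hp
  have hpi := Real.pi_pos
  have : Real.cos (Real.pi / p) < Real.cos 0 :=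
    Real.cos_lt_cos_of_nonneg_of_le_pi le_rfl (div_le_self hpi.le hp') (by positivity)
  rw [Real.cos_zero] at this
  unfold friezeLambda
  linarith

theorem friezeLambda_three : friezeLambda 3 = 1 := by
  simp [friezeLambda]

theorem one_le_friezeLambda {p : ℕ} (hp : 3 ≤ p) : 1 ≤ friezeLambda p :=
  friezeLambda_three ▸ friezeLambda_le (by norm_num) hp

theorem lambdaSum_le {A A' : Multiset ℕ} (hA : ∀ p ∈ A, 3 ≤ p) (h : A' ≤ A) :
    lambdaSum A' ≤ lambdaSum A := by
  obtain ⟨C, rfl⟩ := Multiset.le_iff_exists_add.1 h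
  unfold lambdaSum
  rw [Multiset.map_add, Multiset.sum_add]
  have : 0 ≤ (C.map friezeLambda).sum := by
    apply Multiset.sum_nonneg
    intro x hx
    obtain ⟨p, hp, rfl⟩ := Multiset.mem_map.1 hx
    exact zero_le_one.trans (one_le_friezeLambda (hA p (Multiset.mem_add.2 (Or.inr hp))))
  linarith

/-- The skeletal criteria yield a block decomposition whose dissection has a quiddity cycle
dominated by that of the frieze pattern. -/
theorem InfiniteFrieze.SatisfiesSkeletalCriteria.exists_block_le {F : InfiniteFrieze ℝ} {n : ℕ}
    [NeZero n] (hper : F.IsPeriodic n) (hcrit : F.SatisfiesSkeletalCriteria n) :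
    ∃ (B : Set ℤ) (lo hi : ℤ → ℤ), B.Nonempty ∧ (∀ i : ℤ, i + n ∈ B ↔ i ∈ B) ∧
      IsBlockDecomposition B lo hi ∧ ∀ i, lambdaSum (blockSizes B lo hi i) ≤ F.quiddity i := by
  obtain ⟨hsk, A, hA, -, q, -, hqA, hq⟩ := hcrit
  have hq0 (i : ℤ) : q i ∈ A i := (Multiset.mem_inter.1 (hqA i)).1
  have hq1 (i : ℤ) : q (i - 1) ∈ A i := by
    have := (Multiset.mem_inter.1 (hqA (i - 1))).2
    rwa [sub_add_cancel] at this
  have hq3 (i : ℤ) : 3 ≤ q i := (hA i).1 _ (hq0 i)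
  -- These will be the `i` with `|A i| > 1`, since `1 ≤ λ_p < 2`. Defining `B` through the quiddity
  -- makes it `n`-periodic, which the `A i` are not assumed to be.
  set B : Set ℤ := {i | 2 ≤ F.quiddity i}
  have hpair (i : ℤ) (hi : 1 < (A i).card) : ({q (i - 1), q i} : Multiset ℕ) ≤ A i := by
    by_cases h : q (i - 1) = q i
    · exact hq i hi h
    · refine (Multiset.le_iff_subset ?_).2 ?_
      · simpa using h
      · intro p hp
        rcases Multiset.mem_cons.1 hp with rfl | hp
        · exact hq1 i
        · rw [Multiset.mem_singleton.1 hp]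
          exact hq0 i
  have hbig (i : ℤ) (hi : 1 < (A i).card) :
      friezeLambda (q (i - 1)) + friezeLambda (q i) ≤ F.quiddity i := by
    rw [(hA i).2]
    refine le_trans (le_of_eq ?_) (lambdaSum_le (hA i).1 (hpair i hi))
    simp [lambdaSum]
  have hsmall (i : ℤ) (hi : ¬ 1 < (A i).card) :
      q (i - 1) = q i ∧ F.quiddity i = friezeLambda (q i) := by
    have hpos := Multiset.card_pos_iff_exists_mem.2 ⟨_, hq0 i⟩
    obtain ⟨p, hp⟩ := Multiset.card_eq_one.1 (show (A i).card = 1 by omega)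
    have h0 := hq0 i
    have h1 := hq1 i
    rw [hp, Multiset.mem_singleton] at h0 h1
    rw [(hA i).2, hp, h0, h1]
    simp [lambdaSum]
  have hmem (i : ℤ) : i ∈ B ↔ 1 < (A i).card := by
    constructor
    · intro h
      by_contra hi
      have := friezeLambda_lt_two (p := q i) (by have := hq3 i; omega)
      rw [← (hsmall i hi).2] at this
      exact absurd h (not_le.2 this)
    · intro hi
      have h1 := one_le_friezeLambda (hq3 i)
      have h2 := one_le_friezeLambda (hq3 (i - 1))
      have h3 := hbig i hi
      show 2 ≤ F.quiddity i
      linarith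
  have hBper (i : ℤ) : i + n ∈ B ↔ i ∈ B := by
    show 2 ≤ F.quiddity (i + n) ↔ 2 ≤ F.quiddity i
    rw [hper i]
  -- Outside `B` the multiset `A i` is a singleton, so the chosen `q` cannot change along a run.
  have hrun (b : ℤ) (k : ℕ) (hk : ∀ l : ℕ, l < k → b + l + 1 ∉ B) :
      ∀ l : ℕ, l < k → q (b + l + 1) = q b ∧ F.quiddity (b + l + 1) = friezeLambda (q b) := by
    intro l
    induction l with
    | zero =>
      intro hl
      have := hsmall _ (fun h => hk 0 hl ((hmem _).2 h))
      rw [add_sub_cancel_right] at this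
      simp only [Nat.cast_zero, add_zero] at this ⊢
      rw [this.2, ← this.1]
      exact ⟨rfl, rfl⟩
    | succ l ih =>
      intro hl
      have h0 := ih (by omega)
      have := hsmall _ (fun h => hk (l + 1) hl ((hmem _).2 h))
      rw [add_sub_cancel_right] at this
      rw [show b + ((l + 1 : ℕ) : ℤ) = b + l + 1 by push_cast; ring] at this ⊢
      rw [this.2, ← this.1, h0.1]
      exact ⟨rfl, rfl⟩
  have hshort (b : ℤ) (k : ℕ) (hk : ∀ l : ℕ, l < k → b + l + 1 ∉ B) : k < q b - 2 := by
    by_contra hle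
    refine hsk (q b) (hq3 b) ⟨b + 1, fun l hl => ?_⟩
    have := (hrun b k hk l (by omega)).2
    rwa [show b + 1 + (l : ℤ) = b + l + 1 by ring]
  have hBne : B.Nonempty := by
    by_contra hemp
    rw [Set.not_nonempty_iff_eq_empty] at hemp
    have := hshort 0 (q 0) (by simp [hemp])
    omega
  obtain ⟨lo, hi, h⟩ := exists_isBlockDecomposition hBper hBne
  -- A block with `k` inner vertices has `k + 3` sides, so the strict bound `k < q - 2` gives
  -- exactly `k + 3 ≤ q`.
  have hsize (i : ℤ) : blockSize lo hi i ≤ q i := by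
    have hlo := h.lo_le i
    have hhi := h.lt_hi i
    have hN := h.cast_blockSize i
    have hk (l : ℕ) (hl : l < (hi i - lo i - 1).toNat) : lo i + l + 1 ∉ B :=
      h.not_mem i _ (by omega) (by omega)
    have h1 := hshort (lo i) _ hk
    have h2 : q i = q (lo i) := by
      rcases hlo.eq_or_lt with e | hlt
      · rw [e]
      · have := (hrun (lo i) _ hk (i - lo i - 1).toNat (by omega)).1
        rwa [show lo i + ((i - lo i - 1).toNat : ℤ) + 1 = i by omega] at this
    omega
  have hlam (i : ℤ) : friezeLambda (blockSize lo hi i) ≤ friezeLambda (q i) :=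
    friezeLambda_le (by have := h.three_le_blockSize i; omega) (hsize i)
  refine ⟨B, lo, hi, hBne, hBper, h, fun i => ?_⟩
  by_cases hiB : i ∈ B
  · have h1 := hbig i ((hmem i).1 hiB)
    have h2 := hlam i
    have h3 := hlam (i - 1)
    simp only [blockSizes, hiB, if_true, lambdaSum, Multiset.insert_eq_cons, Multiset.map_cons,
      Multiset.map_singleton, Multiset.sum_cons, Multiset.sum_singleton]
    linarith
  · have h1 := hsmall i fun hc => hiB ((hmem i).2 hc)
    rw [h1.2]
    simpa [blockSizes, hiB, lambdaSum] using hlam i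

/-! ### Subgons of the lifted dissection and ears -/

namespace PuncturedDiscDissection

variable {n : ℕ}

/-- The lifts of the boundary vertices that are joined to the puncture. -/
def bridged (D : PuncturedDiscDissection n) : Set ℤ :=
  {i | PuncturedDiscArc.bridging (i : ZMod n) ∈ D.arcs}

theorem bridged_nonempty (D : PuncturedDiscDissection n) : D.bridged.Nonempty := by
  obtain ⟨v, hv⟩ := D.exists_bridging
  obtain ⟨i, rfl⟩ := ZMod.intCast_surjective v
  exact ⟨i, hv⟩

theorem add_mem_bridged (D : PuncturedDiscDissection n) (i : ℤ) :
    i + n ∈ D.bridged ↔ i ∈ D.bridged := by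
  simp [bridged]

theorem edge_succ (D : PuncturedDiscDissection n) (a : ℤ) :
    D.Edge (a : WithTop ℤ) ((a + 1 : ℤ) : WithTop ℤ) :=
  Or.inl ⟨a, rfl, rfl⟩

theorem edge_top_iff (D : PuncturedDiscDissection n) (a : ℤ) :
    D.Edge (a : WithTop ℤ) ⊤ ↔ a ∈ D.bridged := by
  constructor
  · rintro (⟨b, -, h⟩ | ⟨α, hα, hl⟩)
    · exact absurd h.symm WithTop.coe_ne_top
    · cases α with
      | bridging v =>
        obtain ⟨b, hb, h, -⟩ := hl
        rw [WithTop.coe_inj.1 h]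
        rwa [← hb] at hα
      | peripheral v l h1 h2 =>
        obtain ⟨b, -, -, h⟩ := hl
        exact absurd h.symm WithTop.coe_ne_top
  · exact fun h => Or.inr ⟨_, h, a, rfl, rfl, rfl⟩

/-- Extends the non-crossing of arcs to boundary edges, which have no vertex strictly between their
endpoints. -/
theorem not_interlace (D : PuncturedDiscDissection n) {x y z w : WithTop ℤ} (h1 : D.Edge x y)
    (h2 : D.Edge z w) (hxz : x < z) (hzy : z < y) (hyw : y < w) : False := by
  have no_between {t : WithTop ℤ} {a : ℤ} (h : (a : WithTop ℤ) < t)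
      (h' : t < ((a + 1 : ℤ) : WithTop ℤ)) : False := by
    obtain ⟨b, rfl⟩ := WithTop.ne_top_iff_exists.1 h'.ne_top
    have := WithTop.coe_lt_coe.1 h
    have := WithTop.coe_lt_coe.1 h'
    omega
  rcases h1 with ⟨a, rfl, rfl⟩ | ⟨α, hα, hl⟩
  · exact no_between hxz hzy
  rcases h2 with ⟨a, rfl, rfl⟩ | ⟨β, hβ, hl'⟩
  · exact no_between hzy hyw
  exact D.noncrossing α hα β hβ ⟨x, y, z, w, hl, hl', hxz, hzy, hyw⟩

namespace IsSubgon

variable {D : PuncturedDiscDissection n} {Q : Finset (WithTop ℤ)}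

/-- A point strictly between two vertices of a subgon, but not a vertex itself, lies under a side
joining consecutive vertices. -/
theorem exists_side_across (hQ : D.IsSubgon Q) {x y t : WithTop ℤ} (hx : x ∈ Q) (hy : y ∈ Q)
    (ht : t ∉ Q) (hxt : x < t) (hty : t < y) :
    ∃ c ∈ Q, ∃ d ∈ Q, x ≤ c ∧ c < t ∧ t < d ∧ d ≤ y ∧ D.Edge c d ∧
      ∀ z ∈ Q, ¬ (c < z ∧ z < d) := by
  obtain ⟨c, hc, hcmax⟩ := Finset.exists_max_image (Q.filter (· < t)) id
    ⟨x, Finset.mem_filter.2 ⟨hx, hxt⟩⟩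
  obtain ⟨d, hd, hdmin⟩ := Finset.exists_min_image (Q.filter (t < ·)) id
    ⟨y, Finset.mem_filter.2 ⟨hy, hty⟩⟩
  obtain ⟨hcQ, hct⟩ := Finset.mem_filter.1 hc
  obtain ⟨hdQ, htd⟩ := Finset.mem_filter.1 hd
  have hcons : ∀ z ∈ Q, ¬ (c < z ∧ z < d) := by
    rintro z hz ⟨h1, h2⟩
    rcases lt_trichotomy z t with h | h | h
    · exact absurd (hcmax z (Finset.mem_filter.2 ⟨hz, h⟩)) (not_le.2 h1)
    · exact ht (h ▸ hz)
    · exact absurd (hdmin z (Finset.mem_filter.2 ⟨hz, h⟩)) (not_le.2 h2)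
  exact ⟨c, hcQ, d, hdQ, hcmax x (Finset.mem_filter.2 ⟨hx, hxt⟩), hct, htd,
    hdmin y (Finset.mem_filter.2 ⟨hy, hty⟩),
    (hQ.2 c hcQ d hdQ (hct.trans htd)).2 (Or.inl fun ⟨z, hz, h⟩ => hcons z hz h), hcons⟩

/-- The least and the greatest vertex of a subgon are joined by a side and not consecutive. -/
theorem exists_extremes (hQ : D.IsSubgon Q) :
    ∃ m ∈ Q, ∃ M ∈ Q, D.Edge m M ∧ (∃ z ∈ Q, m < z ∧ z < M) ∧ ∀ z ∈ Q, m ≤ z ∧ z ≤ M := by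
  have hne : Q.Nonempty := Finset.card_pos.1 (by have := hQ.1; omega)
  have hb : ∀ z ∈ Q, Q.min' hne ≤ z ∧ z ≤ Q.max' hne :=
    fun z hz => ⟨Q.min'_le z hz, Q.le_max' z hz⟩
  have hz : ∃ z ∈ Q, Q.min' hne < z ∧ z < Q.max' hne := by
    by_contra hno
    have hsub : Q ⊆ {Q.min' hne, Q.max' hne} := by
      intro z hz
      rw [Finset.mem_insert, Finset.mem_singleton]
      by_contra hz'
      push Not at hz'
      exact hno ⟨z, hz, (hb z hz).1.lt_of_ne hz'.1.symm, (hb z hz).2.lt_of_ne hz'.2⟩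
    have := (Finset.card_le_card hsub).trans Finset.card_le_two
    have := hQ.1
    omega
  refine ⟨_, Q.min'_mem hne, _, Q.max'_mem hne, ?_, hz, hb⟩
  obtain ⟨z, -, h1, h2⟩ := hz
  exact (hQ.2 _ (Q.min'_mem hne) _ (Q.max'_mem hne) (h1.trans h2)).2 (Or.inr hb)

/-- A subgon with a vertex strictly under an edge lies under this edge. -/
theorem mem_Icc_of_edge (hQ : D.IsSubgon Q) {a e i : WithTop ℤ} (hae : D.Edge a e) (hi : i ∈ Q)
    (hai : a < i) (hie : i < e) : ∀ z ∈ Q, a ≤ z ∧ z ≤ e := by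
  obtain ⟨m, hm, M, hM, hmM, -, hb⟩ := hQ.exists_extremes
  by_cases ha : a ∈ Q
  · by_cases he : e ∈ Q
    · rcases (hQ.2 a ha e he (hai.trans hie)).1 hae with h | h
      · exact absurd ⟨i, hi, hai, hie⟩ h
      · exact h
    -- If `e` is not a vertex of `Q` and `Q` reaches beyond it, a side of `Q` passes over `e` and
    -- interlaces with the edge.
    · have hup : ∀ z ∈ Q, z ≤ e := by
        intro z hz
        by_contra hlt
        obtain ⟨c, -, d, -, h1, h2, h3, -, hcd, -⟩ :=
          hQ.exists_side_across hi hz he hie (not_le.1 hlt)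
        exact D.not_interlace hae hcd (hai.trans_le h1) h2 h3
      have hMe : M < e := (hup M hM).lt_of_ne fun h => he (h ▸ hM)
      have hma : a ≤ m := by
        by_contra hlt
        exact D.not_interlace hmM hae (not_le.1 hlt) (hai.trans_le (hb i hi).2) hMe
      exact fun z hz => ⟨hma.trans (hb z hz).1, hup z hz⟩
  · have hlow : ∀ z ∈ Q, a ≤ z := by
      intro z hz
      by_contra hlt
      obtain ⟨c, -, d, -, -, h2, h3, h4, hcd, -⟩ :=
        hQ.exists_side_across hz hi ha (not_le.1 hlt) hai
      exact D.not_interlace hcd hae h2 h3 (h4.trans_lt hie)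
    have ham : a < m := (hlow m hm).lt_of_ne fun h => ha (h ▸ hm)
    have hMe : M ≤ e := by
      by_contra hlt
      exact D.not_interlace hae hmM ham ((hb i hi).1.trans_lt hie) (not_le.1 hlt)
    exact fun z hz => ⟨hlow z hz, (hb z hz).2.trans hMe⟩

end IsSubgon

/-- The lifts of the boundary vertices from `a` to `b`. -/
def interval (a b : ℤ) : Finset (WithTop ℤ) :=
  (Finset.Icc a b).map ⟨_, WithTop.coe_injective⟩

theorem coe_mem_interval {a b i : ℤ} : (i : WithTop ℤ) ∈ interval a b ↔ a ≤ i ∧ i ≤ b := by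
  simp [interval]

theorem exists_coe_of_mem_interval {a b : ℤ} {x : WithTop ℤ} (hx : x ∈ interval a b) :
    ∃ i : ℤ, (i : WithTop ℤ) = x ∧ a ≤ i ∧ i ≤ b := by
  obtain ⟨i, hi, rfl⟩ := Finset.mem_map.1 hx
  exact ⟨i, rfl, Finset.mem_Icc.1 hi⟩

theorem card_interval (a b : ℤ) : (interval a b).card = (b + 1 - a).toNat := by
  simp [interval]

theorem top_notMem_interval (a b : ℤ) : (⊤ : WithTop ℤ) ∉ interval a b := by
  simp [interval]

/-- The only subgon at a vertex strictly under an edge which has no shorter arcs under it. -/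
theorem sizesAt_of_innermost [NeZero n] (D : PuncturedDiscDissection n) {a : ℤ} {l : ℕ}
    (h2 : 2 ≤ l) (hE : D.Edge (a : WithTop ℤ) ((a + l : ℤ) : WithTop ℤ))
    (hin : ∀ x y : ℤ, a ≤ x → y ≤ a + l → D.Edge (x : WithTop ℤ) (y : WithTop ℤ) →
      y = x + 1 ∨ (x = a ∧ y = a + l)) {i : ℤ} (hai : a < i) (hil : i < a + l) :
    D.sizesAt i = {l + 1} := by
  have hsub : D.IsSubgon (interval a (a + l)) := by
    refine ⟨by rw [card_interval]; omega, fun x hx y hy hxy => ?_⟩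
    obtain ⟨x, rfl, hx1, hx2⟩ := exists_coe_of_mem_interval hx
    obtain ⟨y, rfl, hy1, hy2⟩ := exists_coe_of_mem_interval hy
    have hxy' := WithTop.coe_lt_coe.1 hxy
    constructor
    · intro h
      rcases hin x y hx1 hy2 h with rfl | ⟨rfl, rfl⟩
      · left
        rintro ⟨z, hz, h1, h2⟩
        obtain ⟨z, rfl, -⟩ := exists_coe_of_mem_interval hz
        have := WithTop.coe_lt_coe.1 h1
        have := WithTop.coe_lt_coe.1 h2
        omega
      · right
        intro z hz
        obtain ⟨z, rfl, h1, h2⟩ := exists_coe_of_mem_interval hz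
        exact ⟨WithTop.coe_le_coe.2 h1, WithTop.coe_le_coe.2 h2⟩
    · rintro (h | h)
      · have : y = x + 1 := by
          by_contra hne
          exact h ⟨((x + 1 : ℤ) : WithTop ℤ), coe_mem_interval.2 ⟨by omega, by omega⟩,
            WithTop.coe_lt_coe.2 (by omega), WithTop.coe_lt_coe.2 (by omega)⟩
        rw [this]
        exact D.edge_succ x
      · have h1 := (h a (coe_mem_interval.2 ⟨le_rfl, by omega⟩)).1
        have h2 := (h (a + l : ℤ) (coe_mem_interval.2 ⟨by omega, le_rfl⟩)).2
        have h1 := WithTop.coe_le_coe.1 h1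
        have h2 := WithTop.coe_le_coe.1 h2
        rw [show x = a by omega, show y = a + l by omega]
        exact hE
  have huniq : ∀ Q, D.IsSubgon Q → (i : WithTop ℤ) ∈ Q → Q = interval a (a + l) := by
    intro Q hQ hi
    have hIcc := hQ.mem_Icc_of_edge hE hi (WithTop.coe_lt_coe.2 hai) (WithTop.coe_lt_coe.2 hil)
    have hcoe : ∀ z ∈ Q, ∃ k : ℤ, (k : WithTop ℤ) = z ∧ a ≤ k ∧ k ≤ a + l := by
      intro z hz
      obtain ⟨h1, h2⟩ := hIcc z hz
      obtain ⟨k, rfl⟩ := WithTop.ne_top_iff_exists.1 (ne_top_of_le_ne_top WithTop.coe_ne_top h2)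
      exact ⟨k, rfl, WithTop.coe_le_coe.1 h1, WithTop.coe_le_coe.1 h2⟩
    obtain ⟨m, hm, M, hM, hmM, ⟨z, hz, hmz, hzM⟩, hb⟩ := hQ.exists_extremes
    obtain ⟨m, rfl, hm1, hm2⟩ := hcoe m hm
    obtain ⟨M, rfl, hM1, hM2⟩ := hcoe M hM
    obtain ⟨z, rfl, -⟩ := hcoe z hz
    have hmz := WithTop.coe_lt_coe.1 hmz
    have hzM := WithTop.coe_lt_coe.1 hzM
    obtain ⟨rfl, rfl⟩ : m = a ∧ M = a + l := by
      rcases hin m M hm1 hM2 hmM with h | h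
      · omega
      · exact h
    apply Finset.Subset.antisymm
    · intro z hz
      obtain ⟨k, rfl, h⟩ := hcoe z hz
      exact coe_mem_interval.2 h
    · intro t ht
      by_contra htQ
      obtain ⟨t, rfl, h1, h2⟩ := exists_coe_of_mem_interval ht
      have h1' : m ≠ t := fun h => htQ (h ▸ hm)
      have h2' : t ≠ m + l := fun h => htQ (h ▸ hM)
      obtain ⟨c, hc, d, hd, -, hct, htd, -, hcd, hno⟩ := hQ.exists_side_across hm hM htQ
        (WithTop.coe_lt_coe.2 (by omega)) (WithTop.coe_lt_coe.2 (by omega))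
      obtain ⟨c, rfl, hc1, hc2⟩ := hcoe c hc
      obtain ⟨d, rfl, hd1, hd2⟩ := hcoe d hd
      have hct := WithTop.coe_lt_coe.1 hct
      have htd := WithTop.coe_lt_coe.1 htd
      rcases hin c d hc1 hd2 hcd with h | ⟨rfl, rfl⟩
      · omega
      · exact hno i hi ⟨WithTop.coe_lt_coe.2 hai, WithTop.coe_lt_coe.2 hil⟩
  have hset : (D.subgonsAt_finite i).toFinset = {interval a (a + l)} := by
    ext Q
    rw [Set.Finite.mem_toFinset, Finset.mem_singleton]
    refine ⟨fun h => huniq Q h.1 h.2, ?_⟩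
    rintro rfl
    exact ⟨hsub, coe_mem_interval.2 ⟨hai.le, hil.le⟩⟩
  rw [sizesAt, hset]
  simp [card_interval]
  omega

/-- A dissection with a peripheral arc has an ear, so its frieze pattern is not skeletal. -/
theorem exists_eq_bridging_of_isSkeletal [NeZero n] (D : PuncturedDiscDissection n)
    {F : InfiniteFrieze ℝ} (hsk : F.IsSkeletal)
    (hF : ∀ i, F.quiddity i = lambdaSum (D.sizesAt i)) {α : PuncturedDiscArc n}
    (hα : α ∈ D.arcs) : ∃ v, α = .bridging v := by
  classical
  by_contra hno
  have hex : ∃ l : ℕ, ∃ (v : ZMod n) (h1 : 2 ≤ l) (h2 : l ≤ n),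
      PuncturedDiscArc.peripheral v l h1 h2 ∈ D.arcs := by
    cases α with
    | bridging v => exact absurd ⟨v, rfl⟩ hno
    | peripheral v l h1 h2 => exact ⟨l, v, h1, h2, hα⟩
  -- A shortest peripheral arc has no arc properly under it. It cuts off an `(l + 1)`-gon whose `l -
  -- 1 = (l + 1) - 2` inner vertices all carry `λ_(l+1)`, exactly the forbidden length of run.
  obtain ⟨v, h1, h2, hv⟩ := Nat.find_spec hex
  have hmin := fun k hk => Nat.find_min hex (m := k) hk
  set l := Nat.find hex
  obtain ⟨a, rfl⟩ := ZMod.intCast_surjective v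
  have hE : D.Edge (a : WithTop ℤ) ((a + l : ℤ) : WithTop ℤ) := Or.inr ⟨_, hv, a, rfl, rfl, rfl⟩
  refine hsk (l + 1) (by omega) ⟨a + 1, fun k hk => ?_⟩
  rw [hF, D.sizesAt_of_innermost h1 hE _ (by omega) (by omega)]
  · simp [lambdaSum]
  · rintro x y hx hy (⟨b, hb1, hb2⟩ | ⟨β, hβ, hl⟩)
    · have := WithTop.coe_injective hb1
      have := WithTop.coe_injective hb2
      omega
    · cases β with
      | bridging w =>
        obtain ⟨b, -, -, h⟩ := hl
        exact absurd h WithTop.coe_ne_top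
      | peripheral w l' h1' h2' =>
        obtain ⟨b, -, hb1, hb2⟩ := hl
        have := WithTop.coe_injective hb1
        have := WithTop.coe_injective hb2
        have : ¬ l' < l := fun hlt => hmin l' hlt ⟨w, h1', h2', hβ⟩
        omega

/-! ### Dissections with bridging arcs only -/

/-- The subgon with vertices `a, …, b` and the puncture. -/
def puncturedInterval (a b : ℤ) : Finset (WithTop ℤ) :=
  Finset.cons ⊤ (interval a b) (top_notMem_interval a b)

theorem coe_mem_puncturedInterval {a b i : ℤ} :
    (i : WithTop ℤ) ∈ puncturedInterval a b ↔ a ≤ i ∧ i ≤ b := by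
  rw [puncturedInterval, Finset.mem_cons, coe_mem_interval]
  exact or_iff_right WithTop.coe_ne_top

theorem top_mem_puncturedInterval (a b : ℤ) : ⊤ ∈ puncturedInterval a b :=
  Finset.mem_cons_self _ _

theorem edge_coe_iff (D : PuncturedDiscDissection n) (hD : ∀ α ∈ D.arcs, ∃ v, α = .bridging v)
    {a b : ℤ} : D.Edge (a : WithTop ℤ) (b : WithTop ℤ) ↔ b = a + 1 := by
  refine ⟨?_, fun h => h ▸ D.edge_succ a⟩
  rintro (⟨c, h1, h2⟩ | ⟨α, hα, hl⟩)
  · have := WithTop.coe_injective h1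
    have := WithTop.coe_injective h2
    omega
  · obtain ⟨v, rfl⟩ := hD α hα
    obtain ⟨b, -, -, h⟩ := hl
    exact absurd h WithTop.coe_ne_top

variable {lo hi : ℤ → ℤ}

theorem isSubgon_block (D : PuncturedDiscDissection n)
    (hD : ∀ α ∈ D.arcs, ∃ v, α = .bridging v) (h : IsBlockDecomposition D.bridged lo hi)
    (i : ℤ) : D.IsSubgon (puncturedInterval (lo i) (hi i)) := by
  have hlo := h.lo_le i
  have hhi := h.lt_hi i
  refine ⟨by rw [puncturedInterval, Finset.card_cons, card_interval]; omega,
    fun x hx y hy hxy => ?_⟩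
  obtain ⟨x, rfl⟩ := WithTop.ne_top_iff_exists.1 hxy.ne_top
  obtain ⟨hx1, hx2⟩ := coe_mem_puncturedInterval.1 hx
  induction y using WithTop.recTopCoe with
  | top =>
    rw [D.edge_top_iff]
    constructor
    · intro hxB
      rcases hx1.eq_or_lt with rfl | hx1
      · right
        intro z hz
        induction z using WithTop.recTopCoe with
        | top => exact ⟨le_top, le_rfl⟩
        | coe z => exact ⟨WithTop.coe_le_coe.2 (coe_mem_puncturedInterval.1 hz).1, le_top⟩
      · rcases hx2.eq_or_lt with rfl | hx2
        · left
          rintro ⟨z, hz, h1, h2⟩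
          obtain ⟨z, rfl⟩ := WithTop.ne_top_iff_exists.1 h2.ne_top
          exact absurd (WithTop.coe_lt_coe.1 h1) (not_lt.2 (coe_mem_puncturedInterval.1 hz).2)
        · exact absurd hxB (h.not_mem i x hx1 hx2)
    · rintro (h' | h')
      · have : x = hi i := by
          by_contra hne
          exact h' ⟨(hi i : ℤ), coe_mem_puncturedInterval.2 ⟨by omega, le_rfl⟩,
            WithTop.coe_lt_coe.2 (by omega), WithTop.coe_lt_top _⟩
        exact this ▸ h.hi_mem i
      · have := WithTop.coe_le_coe.1
          (h' (lo i : ℤ) (coe_mem_puncturedInterval.2 ⟨le_rfl, by omega⟩)).1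
        rw [show x = lo i by omega]
        exact h.lo_mem i
  | coe y =>
    obtain ⟨hy1, hy2⟩ := coe_mem_puncturedInterval.1 hy
    have hxy := WithTop.coe_lt_coe.1 hxy
    rw [D.edge_coe_iff hD]
    constructor
    · rintro rfl
      left
      rintro ⟨z, hz, h1, h2⟩
      obtain ⟨z, rfl⟩ := WithTop.ne_top_iff_exists.1 h2.ne_top
      have := WithTop.coe_lt_coe.1 h1
      have := WithTop.coe_lt_coe.1 h2
      omega
    · rintro (h' | h')
      · by_contra hne
        exact h' ⟨((x + 1 : ℤ) : WithTop ℤ), coe_mem_puncturedInterval.2 ⟨by omega, by omega⟩,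
          WithTop.coe_lt_coe.2 (by omega), WithTop.coe_lt_coe.2 (by omega)⟩
      · exact absurd (h' ⊤ (top_mem_puncturedInterval _ _)).2
          (not_le.2 (WithTop.coe_lt_top y))

/-- With bridging arcs only, an edge between integers joins neighbours. Hence the outermost side
must end at the puncture, the finite vertices have no gaps, and precisely the first and last of them
are bridged. -/
theorem eq_block_of_isSubgon (D : PuncturedDiscDissection n)
    (hD : ∀ α ∈ D.arcs, ∃ v, α = .bridging v) (h : IsBlockDecomposition D.bridged lo hi)
    {Q : Finset (WithTop ℤ)} (hQ : D.IsSubgon Q) {i : ℤ} (hiQ : (i : WithTop ℤ) ∈ Q) :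
    Q = puncturedInterval (lo (i - 1)) (hi (i - 1)) ∨ Q = puncturedInterval (lo i) (hi i) := by
  obtain ⟨m, hm, M', hM', hmM', ⟨z, hz, hmz, hzM'⟩, hb⟩ := hQ.exists_extremes
  obtain ⟨m, rfl⟩ := WithTop.ne_top_iff_exists.1 hmz.ne_top
  obtain ⟨z, rfl⟩ := WithTop.ne_top_iff_exists.1 hzM'.ne_top
  have hmz := WithTop.coe_lt_coe.1 hmz
  obtain rfl : M' = ⊤ := by
    by_contra hne
    obtain ⟨M, rfl⟩ := WithTop.ne_top_iff_exists.1 hne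
    have := (D.edge_coe_iff hD).1 hmM'
    have := WithTop.coe_lt_coe.1 hzM'
    omega
  obtain ⟨M, hM, hMmax⟩ := Finset.exists_max_image (Q.erase ⊤) id
    ⟨i, Finset.mem_erase.2 ⟨WithTop.coe_ne_top, hiQ⟩⟩
  obtain ⟨hMt, hMQ⟩ := Finset.mem_erase.1 hM
  obtain ⟨M, rfl⟩ := WithTop.ne_top_iff_exists.1 hMt
  have hle (k : ℤ) (hk : (k : WithTop ℤ) ∈ Q) : m ≤ k ∧ k ≤ M :=
    ⟨WithTop.coe_le_coe.1 (hb _ hk).1,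
      WithTop.coe_le_coe.1 (hMmax _ (Finset.mem_erase.2 ⟨WithTop.coe_ne_top, hk⟩))⟩
  have hz' := hle z hz
  have hi' := hle i hiQ
  have hmB := (D.edge_top_iff m).1 hmM'
  have hMB : M ∈ D.bridged := by
    rw [← D.edge_top_iff]
    refine (hQ.2 _ hMQ _ hM' (WithTop.coe_lt_top M)).2 (Or.inl ?_)
    rintro ⟨w, hw, h1, h2⟩
    obtain ⟨w, rfl⟩ := WithTop.ne_top_iff_exists.1 h2.ne_top
    exact absurd (WithTop.coe_lt_coe.1 h1) (not_lt.2 (hle w hw).2)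
  have hfill (t : ℤ) (h1 : m ≤ t) (h2 : t ≤ M) : (t : WithTop ℤ) ∈ Q := by
    by_contra htQ
    have h1' : m ≠ t := fun h => htQ (h ▸ hm)
    have h2' : t ≠ M := fun h => htQ (h ▸ hMQ)
    obtain ⟨c, -, d, -, -, hct, htd, hdM, hcd, -⟩ := hQ.exists_side_across hm hMQ htQ
      (WithTop.coe_lt_coe.2 (by omega)) (WithTop.coe_lt_coe.2 (by omega))
    obtain ⟨c, rfl⟩ := WithTop.ne_top_iff_exists.1 hct.ne_top
    obtain ⟨d, rfl⟩ := WithTop.ne_top_iff_exists.1 (ne_top_of_le_ne_top WithTop.coe_ne_top hdM)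
    have := (D.edge_coe_iff hD).1 hcd
    have := WithTop.coe_lt_coe.1 hct
    have := WithTop.coe_lt_coe.1 htd
    omega
  have hnot (t : ℤ) (h1 : m < t) (h2 : t < M) : t ∉ D.bridged := by
    intro ht
    rcases (hQ.2 _ (hfill t h1.le h2.le) _ hM' (WithTop.coe_lt_top t)).1
      ((D.edge_top_iff t).2 ht) with h' | h'
    · exact h' ⟨M, hMQ, WithTop.coe_lt_coe.2 h2, WithTop.coe_lt_top M⟩
    · exact absurd (h' m hm).1 (not_le.2 (WithTop.coe_lt_coe.2 h1))
  have hQeq : Q = puncturedInterval m M := by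
    ext t
    induction t using WithTop.recTopCoe with
    | top => exact ⟨fun _ => top_mem_puncturedInterval _ _, fun _ => hM'⟩
    | coe t =>
      rw [coe_mem_puncturedInterval]
      exact ⟨hle t, fun ht => hfill t ht.1 ht.2⟩
  -- If `i` is the last finite vertex, `Q` is the block to its left, the one indexed by `i - 1`.
  by_cases hiM : i < M
  · right
    obtain ⟨h1, h2⟩ := h.unique hmB hMB hi'.1 hiM hnot
    rw [h1, h2, hQeq]
  · left
    obtain ⟨h1, h2⟩ := h.unique (i := i - 1) hmB hMB (by omega) (by omega) hnot
    rw [h1, h2, hQeq]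

theorem sizesAt_eq_blockSizes [NeZero n] (D : PuncturedDiscDissection n)
    (hD : ∀ α ∈ D.arcs, ∃ v, α = .bridging v) (h : IsBlockDecomposition D.bridged lo hi)
    (i : ℤ) : D.sizesAt i = blockSizes D.bridged lo hi i := by
  classical
  have hcard (j : ℤ) : (puncturedInterval (lo j) (hi j)).card = blockSize lo hi j := by
    have := h.lo_le j
    have := h.lt_hi j
    rw [puncturedInterval, Finset.card_cons, card_interval, blockSize]
    omega
  have hset : (D.subgonsAt_finite i).toFinset =
      {puncturedInterval (lo (i - 1)) (hi (i - 1)), puncturedInterval (lo i) (hi i)} := by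
    ext Q
    rw [Set.Finite.mem_toFinset, Finset.mem_insert, Finset.mem_singleton]
    refine ⟨fun hQ => D.eq_block_of_isSubgon hD h hQ.1 hQ.2, ?_⟩
    have h1 := h.lo_le i
    have h2 := h.lt_hi i
    have h3 := h.lo_le (i - 1)
    have h4 := h.lt_hi (i - 1)
    rintro (rfl | rfl)
    · exact ⟨D.isSubgon_block hD h _, coe_mem_puncturedInterval.2 ⟨by omega, by omega⟩⟩
    · exact ⟨D.isSubgon_block hD h _, coe_mem_puncturedInterval.2 ⟨by omega, by omega⟩⟩
  rw [sizesAt, hset]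
  by_cases hi' : i ∈ D.bridged
  -- The two blocks are distinct in the strip even when they lift the same self-folded subgon, so
  -- equal sizes are counted twice.
  · have hne : puncturedInterval (lo (i - 1)) (hi (i - 1)) ≠ puncturedInterval (lo i) (hi i) := by
      intro heq
      have h1 := h.lt_hi i
      have h2 := h.lo_le i
      have : ((hi i : ℤ) : WithTop ℤ) ∈ puncturedInterval (lo (i - 1)) (hi (i - 1)) := by
        rw [heq]
        exact coe_mem_puncturedInterval.2 ⟨by omega, le_rfl⟩
      have := (coe_mem_puncturedInterval.1 this).2
      rw [h.hi_pred_of_mem hi'] at this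
      omega
    rw [Finset.insert_val_of_notMem (by simpa using hne)]
    simp [blockSizes, hi', hcard]
  · obtain ⟨h1, h2⟩ := h.pred_of_notMem hi'
    simp [blockSizes, hi', hcard, h1, h2]

/-- The dissection by the arcs joining the vertices in `B` to the puncture. -/
def ofBridged (n : ℕ) (B : Set ℤ) (hB : B.Nonempty) : PuncturedDiscDissection n where
  arcs := {α | ∃ i ∈ B, α = .bridging (i : ZMod n)}
  noncrossing := by
    rintro _ ⟨i, -, rfl⟩ _ ⟨j, -, rfl⟩ ⟨x, y, z, w, ⟨-, -, -, rfl⟩, -, -, -, h⟩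
    exact not_top_lt h
  exists_bridging := by
    obtain ⟨i, hi⟩ := hB
    exact ⟨i, i, hi, rfl⟩

theorem bridged_ofBridged {B : Set ℤ} (hB : B.Nonempty) (hper : ∀ i : ℤ, i + n ∈ B ↔ i ∈ B) :
    (ofBridged n B hB).bridged = B := by
  ext i
  constructor
  · rintro ⟨j, hj, hij⟩
    have hij : (i : ZMod n) = j := by simpa using hij
    obtain ⟨t, ht⟩ := (ZMod.intCast_eq_intCast_iff_dvd_sub j i n).1 hij.symm
    have hp : Function.Periodic (fun i => i ∈ B) (n : ℤ) := fun i => propext (hper i)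
    have := hp.int_mul t j
    rw [show i = j + t * n by linarith]
    exact this.mpr hj
  · exact fun hi => ⟨i, hi, rfl⟩

end PuncturedDiscDissection

end

/-! ### The equivalence -/

theorem mainTheorem8 (n : ℕ) [NeZero n] (P : Finset ℕ) (hP : ∀ p ∈ P, 3 ≤ p)
    (F : InfiniteFrieze ℝ) (hper : F.IsPeriodic n) (hType : F.IsOfType P)
    (hcrit : F.SatisfiesSkeletalCriteria n) :
    F.RealizableOnPuncturedDisc n ↔ F.growthCoeff n 1 = 2 := by
  constructor
  · rintro ⟨D, hF⟩
    have hD := fun α hα => D.exists_eq_bridging_of_isSkeletal hcrit.1 hF (α := α) hα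
    obtain ⟨lo, hi, h⟩ := exists_isBlockDecomposition D.add_mem_bridged D.bridged_nonempty
    refine F.growthCoeff_eq_two_of_solution n h.punctureLength_pos
      (h.punctureLength_add_period D.add_mem_bridged) fun i => ?_
    rw [h.punctureLength_recurrence, hF, D.sizesAt_eq_blockSizes hD h]
  · intro h2
    obtain ⟨B, lo, hi, hne, hB, h, hle⟩ := hcrit.exists_block_le hper
    have hb := PuncturedDiscDissection.bridged_ofBridged hne hB
    refine ⟨.ofBridged n B hne, fun i => ?_⟩
    -- `f` now solves both its own recurrence and that of the frieze; dividing by `f i > 0`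
    -- identifies the coefficients.
    have hsol := F.solution_of_growthCoeff_eq_two n hper h.punctureLength_pos
      (h.punctureLength_add_period hB) (fun i => by
        rw [h.punctureLength_recurrence]
        exact mul_le_mul_of_nonneg_right (hle i) (h.punctureLength_pos i).le) h2 i
    rw [h.punctureLength_recurrence] at hsol
    rw [PuncturedDiscDissection.sizesAt_eq_blockSizes _ _ (hb.symm ▸ h), hb]
    · exact (mul_right_cancel₀ (h.punctureLength_pos i).ne' hsol).symm
    · rintro _ ⟨j, -, rfl⟩
      exact ⟨_, rfl⟩
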